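/- A metrical task system (MTS) consists of an $N$-point pseudometric space $({\cal X},d)$, $N\ge 1$, of states and a collection ${\cal L}\subseteq[0,1]^{\cal X}$ of loss vectors; let $D=\max_{x,y\in{\cal X}}d(x,y)$. A (randomized) online algorithm with known time horizon $T$ is, at each step $t=1,\dots,T$, first given a loss vector $l_t\in{\cal L}$ and then chooses, possibly at random and using only $l_1,\dots,l_t$ and its earlier choices, a state $i_t\in{\cal X}$. It has regret at most $R$ on the interval $I=\{t_0+1,\dots,t_0+k\}\subseteq[1,T]$ if, for every sequence $l_1,\dots,l_T\in{\cal L}$ fixed in advance, $$\mathbb{E}\Big[\sum_{t\in I}l_t(i_t)+\sum_{t\in I\setminus\{t_0+1\}}d(i_t,i_{t-1})\Big]\le\min_{x\in{\cal X}}\sum_{t\in I}l_t(x)+R,$$ where the expectation is over the randomization of the algorithm. Corollary. There is a universal constant $C>0$ such that for every MTS with $N$ states and diameter $D$ and every time horizon $T$ there is an online algorithm whose regret on every interval $I\subseteq[1,T]$ (simultaneously) is at most $C\sqrt{(D+1)\,|I|\,\log(NT)}$. -/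

import Mathlib

/-- A metrical task system on the finite nonempty pseudometric space `X` of states: the metric is
that of `X`, and `losses` is the collection of admissible loss vectors, all with values
in `[0, 1]`. -/
structure MetricalTaskSystem (X : Type*) [PseudoMetricSpace X] [Fintype X] [Nonempty X] where
  losses : Set (X → ℝ)
  mem_Icc : ∀ l ∈ losses, ∀ x, l x ∈ Set.Icc (0 : ℝ) 1

namespace MetricalTaskSystem

variable {X : Type*} [PseudoMetricSpace X] [Fintype X] [Nonempty X]

/-- A randomized online algorithm with known time horizon `T`. Step `t : Fin T` is the
`(t + 1)`-st time step. The state at that step is drawn from a distribution which may depend on the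
loss vectors revealed so far, the current one included, and on the states chosen at all
earlier steps. -/
structure OnlineAlgorithm (M : MetricalTaskSystem X) (T : ℕ) where
  next : (t : Fin T) → (seen : Fin (t.val + 1) → M.losses) → (past : Fin t.val → X) → PMF X

namespace OnlineAlgorithm

variable {M : MetricalTaskSystem X} {T : ℕ}

/-- The joint law of the states chosen in the first `n` steps, when the loss sequence is `l`. -/
noncomputable def law (A : M.OnlineAlgorithm T) (l : Fin T → M.losses) :
    (n : ℕ) → n ≤ T → PMF (Fin n → X)
  | 0, _ => PMF.pure Fin.elim0
  | n + 1, h =>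
      (A.law l n (Nat.le_of_succ_le h)).bind fun past =>
        (A.next ⟨n, h⟩ (fun s => l (Fin.castLE h s)) past).map fun x =>
          (Fin.snoc past x : Fin (n + 1) → X)

/-- Expectation of a function of the whole sequence of states chosen by the algorithm. -/
noncomputable def expect (A : M.OnlineAlgorithm T) (l : Fin T → M.losses)
    (f : (Fin T → X) → ℝ) : ℝ :=
  ∑ i : Fin T → X, (A.law l T le_rfl i).toReal * f i

end OnlineAlgorithm

/-- The time interval `{t₀ + 1, …, t₀ + k}`, in terms of the zero-based indices `t₀, …, t₀ + k - 1`
of its steps. -/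
def interval (T t₀ k : ℕ) : Finset (Fin T) :=
  Finset.univ.filter fun t => t₀ ≤ t.val ∧ t.val < t₀ + k

/-- The interval without its first step. -/
def intervalTail (T t₀ k : ℕ) : Finset (Fin T) :=
  Finset.univ.filter fun t => t₀ + 1 ≤ t.val ∧ t.val < t₀ + k

/-- The step before `t` (only used for steps `t` that are not the first one). -/
def prevStep {T : ℕ} (t : Fin T) : Fin T :=
  ⟨t.val - 1, lt_of_le_of_lt (Nat.sub_le _ _) t.isLt⟩

/-- Total cost of the state sequence `i` on an interval: the losses at all its steps, plus the
movement costs at all its steps but the first. -/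
noncomputable def cost {M : MetricalTaskSystem X} {T : ℕ} (l : Fin T → M.losses) (t₀ k : ℕ)
    (i : Fin T → X) : ℝ :=
  ∑ t ∈ interval T t₀ k, (l t).val (i t) +
    ∑ t ∈ intervalTail T t₀ k, dist (i t) (i (prevStep t))

/-- The loss on an interval of the best fixed state. -/
noncomputable def bestFixed {M : MetricalTaskSystem X} {T : ℕ} (l : Fin T → M.losses)
    (t₀ k : ℕ) : ℝ :=
  Finset.univ.inf' Finset.univ_nonempty fun x : X => ∑ t ∈ interval T t₀ k, (l t).val x

/-- `A` has regret at most `R` on the interval `{t₀ + 1, …, t₀ + k}`: for every sequence of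
admissible loss vectors, fixed in advance. -/
def OnlineAlgorithm.HasRegretBound {M : MetricalTaskSystem X} {T : ℕ} (A : M.OnlineAlgorithm T)
    (t₀ k : ℕ) (R : ℝ) : Prop :=
  ∀ l : Fin T → M.losses, A.expect l (cost l t₀ k) ≤ bestFixed l t₀ k + R

end MetricalTaskSystem

/-! Fixed-share multiplicative weights are run over experts `(j, x)`: a state `x` paired with a
learning rate `η` proportional to `1 / (j + 1)`. Experts are played with probability proportional to
`η * w`, so the update `w * (1 + η * excess)` preserves total weight even though the rates differ.

Consecutive plays differ in total variation by at most six times the average rate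
(`sum_max_play_sub_le`), and a coupling turns this into movement cost (`exists_algorithm`). Adding
`6 * (D + 1) * η` to each expert's loss therefore pays for movement in advance: the true cost is at
most the average surrogate loss.

Mixing in a little of the uniform distribution keeps every weight at least `α / |E|`, so the
potential `log w` yields regret on every interval (`sum_excess_le`). An interval of length `k` is
compared with the rate indexed by `m ≈ √(k / ((D + 1) log (NT)))`, which balances `k / m` against
`(D + 1) * m * log (NT)`. -/

/-! ### Expectations and couplings on finite types. -/

namespace PMF

/-- Expectation of a real function under a probability mass function on a finite type. -/
noncomputable def fexp {α : Type*} [Fintype α] (μ : PMF α) (f : α → ℝ) : ℝ :=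
  ∑ a, (μ a).toReal * f a

section fexp

variable {α β : Type*} [Fintype α] [Fintype β]

lemma sum_toReal (μ : PMF α) : ∑ a, (μ a).toReal = 1 := by
  rw [← ENNReal.toReal_sum fun a _ => μ.apply_ne_top a, ← tsum_fintype (L := .unconditional α),
    μ.tsum_coe, ENNReal.toReal_one]

lemma fexp_const (μ : PMF α) (c : ℝ) : μ.fexp (fun _ => c) = c := by
  simp [fexp, ← Finset.sum_mul, sum_toReal]

lemma fexp_add (μ : PMF α) (f g : α → ℝ) :
    μ.fexp (fun a => f a + g a) = μ.fexp f + μ.fexp g := by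
  simp [fexp, mul_add, Finset.sum_add_distrib]

lemma fexp_sum {ι : Type*} (μ : PMF α) (s : Finset ι) (f : ι → α → ℝ) :
    μ.fexp (fun a => ∑ i ∈ s, f i a) = ∑ i ∈ s, μ.fexp (f i) := by
  simp only [fexp, Finset.mul_sum]
  exact Finset.sum_comm

lemma fexp_pure (a : α) (f : α → ℝ) : (PMF.pure a).fexp f = f a := by
  classical
  simp [fexp, PMF.pure_apply, apply_ite ENNReal.toReal]

lemma fexp_bind (μ : PMF α) (κ : α → PMF β) (f : β → ℝ) :
    (μ.bind κ).fexp f = μ.fexp fun a => (κ a).fexp f := by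
  have h : ∀ b, ((μ.bind κ) b).toReal = ∑ a, (μ a).toReal * (κ a b).toReal := fun b => by
    rw [PMF.bind_apply, tsum_fintype, ENNReal.toReal_sum]
    · simp [ENNReal.toReal_mul]
    · exact fun a _ => ENNReal.mul_ne_top (μ.apply_ne_top a) ((κ a).apply_ne_top b)
  simp only [fexp, h, Finset.sum_mul, Finset.mul_sum]
  rw [Finset.sum_comm]
  simp only [mul_assoc]

lemma fexp_map (μ : PMF α) (g : α → β) (f : β → ℝ) :
    (μ.map g).fexp f = μ.fexp fun a => f (g a) := by
  rw [← PMF.bind_pure_comp, fexp_bind]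
  simp [fexp_pure]

lemma exists_toReal_eq (p : α → ℝ) (h0 : ∀ a, 0 ≤ p a) (h1 : ∑ a, p a = 1) :
    ∃ μ : PMF α, ∀ a, (μ a).toReal = p a :=
  ⟨PMF.ofFintype (fun a => ENNReal.ofReal (p a)) (by
    rw [← ENNReal.ofReal_sum_of_nonneg fun a _ => h0 a, h1, ENNReal.ofReal_one]),
    fun a => by simp [h0 a]⟩

/-- Two distributions on a finite type are coupled by a kernel that moves with probability equal to
their total variation distance. -/
lemma exists_kernel [DecidableEq α] (p p' : α → ℝ) (hp : ∀ a, 0 ≤ p a) (hp1 : ∑ a, p a = 1)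
    (hp' : ∀ a, 0 ≤ p' a) (hp1' : ∑ a, p' a = 1) :
    ∃ K : α → PMF α, (∀ b, ∑ a, p a * (K a b).toReal = p' b) ∧
      ∑ a, p a * (K a).fexp (fun b => if b = a then 0 else 1) ≤ ∑ a, max (p a - p' a) 0 := by
  set m : α → ℝ := fun a => min (p a) (p' a) with hm
  have hm0 : ∀ a, 0 ≤ m a := fun a => le_min (hp a) (hp' a)
  have hmp : ∀ a, m a ≤ p a := fun a => min_le_left _ _
  have hmp' : ∀ a, m a ≤ p' a := fun a => min_le_right _ _
  set δ : ℝ := ∑ a, (p' a - m a) with hδ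
  have hδ' : δ = ∑ a, (p a - m a) := by
    rw [hδ, Finset.sum_sub_distrib, Finset.sum_sub_distrib, hp1, hp1']
  -- `δ` is the total variation distance; if it vanishes, `p = p'` and nobody moves.
  rcases (Finset.sum_nonneg fun a _ => sub_nonneg.2 (hmp' a) : 0 ≤ δ).eq_or_lt with h0 | hpos
  · have e1 : ∀ a, p a - m a = 0 := fun a =>
      (Finset.sum_eq_zero_iff_of_nonneg fun a _ => sub_nonneg.2 (hmp a)).1
        (hδ' ▸ h0.symm) a (Finset.mem_univ a)
    have e2 : ∀ a, p' a - m a = 0 := fun a =>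
      (Finset.sum_eq_zero_iff_of_nonneg fun a _ => sub_nonneg.2 (hmp' a)).1
        h0.symm a (Finset.mem_univ a)
    refine ⟨PMF.pure, fun b => ?_, ?_⟩
    · simp only [PMF.pure_apply, apply_ite ENNReal.toReal]
      simp
      linarith [e1 b, e2 b]
    · simp only [fexp_pure]
      simp
      exact Finset.sum_nonneg fun a _ => le_max_right _ _
  -- Maximal coupling: mass `m a` stays put and the surplus `p a - m a` is spread in proportion to
  -- the deficits `p' b - m b`. Where `p a = 0` any law serves.
  have hK : ∀ a, ∃ μ : PMF α, ∀ b, p a * (μ b).toReal =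
      (if b = a then m a else 0) + (p a - m a) * ((p' b - m b) / δ) := fun a => by
    rcases (hp a).eq_or_lt with ha | ha
    · obtain ⟨μ, -⟩ := exists_toReal_eq p' hp' hp1'
      have : m a = 0 := le_antisymm (ha ▸ hmp a) (hm0 a)
      exact ⟨μ, fun b => by simp [← ha, this]⟩
    · obtain ⟨μ, hμ⟩ := exists_toReal_eq
        (fun b => ((if b = a then m a else 0) + (p a - m a) * ((p' b - m b) / δ)) / p a)
        (fun b => by
          have := hm0 a
          have := sub_nonneg.2 (hmp a)
          have := sub_nonneg.2 (hmp' b)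
          split_ifs <;> positivity)
        (by
          rw [← Finset.sum_div, Finset.sum_add_distrib, ← Finset.mul_sum, ← Finset.sum_div, ← hδ,
            div_self hpos.ne']
          simp [ha.ne'])
      exact ⟨μ, fun b => by rw [hμ]; field_simp⟩
  choose K hK using hK
  refine ⟨K, fun b => ?_, ?_⟩
  · simp only [hK]
    rw [Finset.sum_add_distrib, ← Finset.sum_mul, ← hδ', mul_div_cancel₀ _ hpos.ne']
    simp
  · refine Finset.sum_le_sum fun a _ => ?_
    have h1 : p a * (K a).fexp (fun b => if b = a then 0 else 1)
        = p a - p a * (K a a).toReal := by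
      have := (K a).sum_toReal
      rw [← Finset.add_sum_erase _ _ (Finset.mem_univ a)] at this
      rw [fexp, ← Finset.add_sum_erase _ _ (Finset.mem_univ a)]
      rw [Finset.sum_congr rfl (g := fun b => (K a b).toReal)]
      · simp only [if_true, mul_zero, zero_add]
        rw [eq_sub_of_add_eq' this]
        ring
      · intro b hb
        simp [Finset.ne_of_mem_erase hb]
    rw [h1, hK]
    have h2 : 0 ≤ (p a - m a) * ((p' a - m a) / δ) :=
      mul_nonneg (sub_nonneg.2 (hmp a)) (div_nonneg (sub_nonneg.2 (hmp' a)) hpos.le)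
    have h3 : p a - m a ≤ max (p a - p' a) 0 := by
      simp only [hm]
      rcases le_total (p a) (p' a) with h | h <;> simp [h]
    simp only [if_true]
    linarith

end fexp

end PMF

/-! ### From causal distributions to online algorithms. -/

namespace MetricalTaskSystem

/-- Sequences of loss vectors, padded by zero. -/
noncomputable def padLoss {X : Type*} [PseudoMetricSpace X] [Fintype X] [Nonempty X]
    {M : MetricalTaskSystem X} {n : ℕ} (l : Fin n → M.losses) (s : ℕ) : X → ℝ :=
  if h : s < n then (l ⟨s, h⟩).val else 0

lemma padLoss_castLE {X : Type*} [PseudoMetricSpace X] [Fintype X] [Nonempty X]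
    {M : MetricalTaskSystem X} {n T : ℕ} (l : Fin T → M.losses) (h : n ≤ T) {s : ℕ} (hs : s < n) :
    padLoss (fun i => l (Fin.castLE h i)) s = padLoss l s := by
  simp [padLoss, hs, hs.trans_le h]

lemma padLoss_val {X : Type*} [PseudoMetricSpace X] [Fintype X] [Nonempty X]
    {M : MetricalTaskSystem X} {T : ℕ} (l : Fin T → M.losses) (t : Fin T) :
    padLoss l t.val = (l t).val := by
  simp [padLoss]

lemma padLoss_mem_Icc {X : Type*} [PseudoMetricSpace X] [Fintype X] [Nonempty X]
    {M : MetricalTaskSystem X} {T : ℕ} (l : Fin T → M.losses) (s : ℕ) (x : X) :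
    padLoss l s x ∈ Set.Icc (0 : ℝ) 1 := by
  unfold padLoss
  split_ifs
  · exact M.mem_Icc _ (l _).2 x
  · simp

lemma sum_interval {T t₀ k : ℕ} (h : t₀ + k ≤ T) (f : ℕ → ℝ) :
    ∑ t ∈ interval T t₀ k, f t.val = ∑ i ∈ Finset.range k, f (t₀ + i) := by
  refine (Finset.sum_bij (fun i hi => (⟨t₀ + i, ?_⟩ : Fin T)) ?_ ?_ ?_ ?_).symm
  · have := Finset.mem_range.1 hi; omega
  · intro i hi
    have := Finset.mem_range.1 hi
    simp [interval, this]
  · intro i _ j _ hij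
    simpa using hij
  · intro t ht
    simp only [interval, Finset.mem_filter, Finset.mem_univ, true_and] at ht
    exact ⟨t.val - t₀, Finset.mem_range.2 (by omega), Fin.ext (by simp; omega)⟩
  · intros; rfl

/-- Charges each move to the step it leaves from; `prevStep` is injective on the tail and stays in
the interval. -/
lemma sum_intervalTail_le {T t₀ k : ℕ} (h : t₀ + k ≤ T) (f : ℕ → ℝ) (hf : ∀ n, 0 ≤ f n) :
    ∑ t ∈ intervalTail T t₀ k, f (t.val - 1) ≤ ∑ i ∈ Finset.range k, f (t₀ + i) := by
  change ∑ t ∈ intervalTail T t₀ k, (fun t : Fin T => f t.val) (prevStep t) ≤ _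
  rw [← sum_interval h, ← Finset.sum_image (f := fun t : Fin T => f t.val) (g := prevStep)]
  · refine Finset.sum_le_sum_of_subset_of_nonneg ?_ fun _ _ _ => hf _
    intro t ht
    obtain ⟨s, hs, rfl⟩ := Finset.mem_image.1 ht
    simp only [intervalTail, interval, Finset.mem_filter, Finset.mem_univ, true_and,
      prevStep] at hs ⊢
    omega
  · intro s hs t ht hst
    simp only [intervalTail, Finset.coe_filter, Finset.mem_univ, true_and,
      Set.mem_ofPred_eq] at hs ht
    simp only [prevStep, Fin.mk.injEq] at hst
    exact Fin.ext (by omega)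

/-- Every causal sequence of distributions is realized by an online algorithm whose movement cost
is bounded by the diameter times the total variation distance. -/
theorem exists_algorithm {X : Type*} [PseudoMetricSpace X] [Fintype X] [Nonempty X]
    (M : MetricalTaskSystem X) (T : ℕ) (p : (ℕ → X → ℝ) → ℕ → X → ℝ)
    (hcausal : ∀ l l' n, (∀ s < n, l s = l' s) → p l n = p l' n)
    (hp0 : ∀ (l : Fin T → M.losses) n x, 0 ≤ p (padLoss l) n x)
    (hp1 : ∀ (l : Fin T → M.losses) n, ∑ x, p (padLoss l) n x = 1) :
    ∃ A : M.OnlineAlgorithm T, ∀ (l : Fin T → M.losses) (t₀ k : ℕ), t₀ + k ≤ T →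
      A.expect l (cost l t₀ k) ≤ ∑ i ∈ Finset.range k,
        (∑ x, p (padLoss l) (t₀ + i) x * padLoss l (t₀ + i) x +
          Metric.diam (Set.univ : Set X) *
            ∑ x, max (p (padLoss l) (t₀ + i) x - p (padLoss l) (t₀ + i + 1) x) 0) := by
  classical
  -- Initial laws and kernels are chosen for all functions, with junk values off the simplex, so
  -- that they depend on the distributions alone.
  have hi : ∀ q : X → ℝ, ∃ μ : PMF X, (∀ x, 0 ≤ q x) → ∑ x, q x = 1 →
      ∀ x, (μ x).toReal = q x := fun q => by
    by_cases h : (∀ x, 0 ≤ q x) ∧ ∑ x, q x = 1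
    · obtain ⟨μ, hμ⟩ := PMF.exists_toReal_eq q h.1 h.2
      exact ⟨μ, fun _ _ => hμ⟩
    · exact ⟨PMF.pure (Classical.arbitrary X), fun h1 h2 => absurd ⟨h1, h2⟩ h⟩
  choose init hinit using hi
  have hk : ∀ q q' : X → ℝ, ∃ K : X → PMF X,
      (∀ x, 0 ≤ q x) → ∑ x, q x = 1 → (∀ x, 0 ≤ q' x) → ∑ x, q' x = 1 →
      (∀ y, ∑ x, q x * (K x y).toReal = q' y) ∧
      ∑ x, q x * (K x).fexp (fun y => if y = x then 0 else 1) ≤ ∑ x, max (q x - q' x) 0 :=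
    fun q q' => by
      by_cases h : ((∀ x, 0 ≤ q x) ∧ ∑ x, q x = 1) ∧ ((∀ x, 0 ≤ q' x) ∧ ∑ x, q' x = 1)
      · obtain ⟨K, hK⟩ := PMF.exists_kernel q q' h.1.1 h.1.2 h.2.1 h.2.2
        exact ⟨K, fun _ _ _ _ => hK⟩
      · exact ⟨PMF.pure, fun h1 h2 h3 h4 => absurd ⟨⟨h1, h2⟩, ⟨h3, h4⟩⟩ h⟩
  choose ker hker using hk
  let A : M.OnlineAlgorithm T :=
    { next := fun t seen past =>
        if h : 0 < t.val then
          ker (p (padLoss seen) (t.val - 1)) (p (padLoss seen) t.val)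
            (past ⟨t.val - 1, Nat.sub_lt h one_pos⟩)
        else init (p (padLoss seen) 0) }
  -- By causality, padding the visible prefix gives the same distributions as padding the full
  -- sequence.
  have hp : ∀ (l : Fin T → M.losses) {n m : ℕ} (h : n < T), m ≤ n →
      p (padLoss fun s : Fin (n + 1) => l (Fin.castLE h s)) m = p (padLoss l) m :=
    fun l n m h hm => hcausal _ _ _ fun s hs => padLoss_castLE l h (by omega)
  have hsucc : ∀ (l : Fin T → M.losses) (n : ℕ) (h : n + 1 ≤ T) (f : (Fin (n + 1) → X) → ℝ),
      (A.law l (n + 1) h).fexp f = (A.law l n (Nat.le_of_succ_le h)).fexp fun past =>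
        (A.next ⟨n, h⟩ (fun s => l (Fin.castLE h s)) past).fexp fun x =>
          f (Fin.snoc past x) := fun l n h f => by
    rw [OnlineAlgorithm.law, PMF.fexp_bind]
    simp only [PMF.fexp_map]
  have hnext0 : ∀ (l : Fin T → M.losses) (h : 0 < T) (past : Fin 0 → X),
      A.next ⟨0, h⟩ (fun s => l (Fin.castLE h s)) past = init (p (padLoss l) 0) :=
    fun l h past => by
      simp only [A, lt_irrefl, dif_neg, not_false_eq_true]
      rw [hp l h le_rfl]
  have hnext1 : ∀ (l : Fin T → M.losses) (n : ℕ) (h : n + 1 < T) (past : Fin (n + 1) → X),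
      A.next ⟨n + 1, h⟩ (fun s => l (Fin.castLE h s)) past =
        ker (p (padLoss l) n) (p (padLoss l) (n + 1)) (past (Fin.last n)) :=
    fun l n h past => by
      simp only [A, Nat.succ_pos, dif_pos, Nat.add_sub_cancel]
      rw [hp l h le_rfl, hp l h (Nat.le_succ n)]
      rfl
  have hmarg : ∀ (l : Fin T → M.losses) (n : ℕ) (h : n ≤ T) (s : Fin n) (f : X → ℝ),
      (A.law l n h).fexp (fun i => f (i s)) = ∑ x, p (padLoss l) s.val x * f x := by
    intro l n
    induction n with
    | zero => exact fun _ s => s.elim0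
    | succ n ih =>
      intro h s f
      rw [hsucc]
      refine Fin.lastCases ?_ (fun s => ?_) s
      · simp only [Fin.snoc_last, Fin.val_last]
        rcases n with _ | n
        · simp only [hnext0, PMF.fexp_const]
          simp only [PMF.fexp, hinit _ (hp0 l 0) (hp1 l 0)]
        · simp only [hnext1]
          rw [ih (Nat.le_of_succ_le h) (Fin.last n) (fun x =>
            (ker (p (padLoss l) n) (p (padLoss l) (n + 1)) x).fexp f)]
          simp only [PMF.fexp, Fin.val_last, Finset.mul_sum, ← mul_assoc]
          rw [Finset.sum_comm]
          simp only [← Finset.sum_mul]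
          simp only [(hker _ _ (hp0 l n) (hp1 l n) (hp0 l (n + 1)) (hp1 l (n + 1))).1]
      · simp only [Fin.snoc_castSucc, PMF.fexp_const, Fin.val_castSucc]
        exact ih _ s f
  have hdist : ∀ x y : X, dist x y ≤ Metric.diam (Set.univ : Set X) := fun x y =>
    Metric.dist_le_diam_of_mem Set.finite_univ.isBounded (Set.mem_univ x) (Set.mem_univ y)
  have hpair : ∀ (l : Fin T → M.losses) (n : ℕ) (h : n ≤ T) (s : ℕ) (hs : s + 1 < n),
      (A.law l n h).fexp (fun i => dist (i ⟨s + 1, hs⟩) (i ⟨s, Nat.lt_of_succ_lt hs⟩)) ≤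
        Metric.diam (Set.univ : Set X) *
          ∑ x, max (p (padLoss l) s x - p (padLoss l) (s + 1) x) 0 := by
    intro l n
    induction n with
    | zero => exact fun _ s hs => by omega
    | succ n ih =>
      intro h s hs
      rw [hsucc]
      rcases (Nat.lt_succ_iff.1 hs).eq_or_lt with rfl | hlt
      · have e1 : (⟨s + 1, hs⟩ : Fin (s + 1 + 1)) = Fin.last _ := rfl
        have e2 : (⟨s, Nat.lt_of_succ_lt hs⟩ : Fin (s + 1 + 1)) = (Fin.last s).castSucc := rfl
        simp only [e1, e2, Fin.snoc_last, Fin.snoc_castSucc, hnext1]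
        rw [hmarg l _ (Nat.le_of_succ_le h) (Fin.last s) (fun x =>
          (ker (p (padLoss l) s) (p (padLoss l) (s + 1)) x).fexp fun y => dist y x)]
        refine le_trans ?_ (mul_le_mul_of_nonneg_left
          (hker _ _ (hp0 l s) (hp1 l s) (hp0 l (s + 1)) (hp1 l (s + 1))).2 Metric.diam_nonneg)
        rw [Finset.mul_sum]
        refine Finset.sum_le_sum fun x _ => ?_
        rw [mul_left_comm]
        refine mul_le_mul_of_nonneg_left ?_ (hp0 l _ x)
        rw [PMF.fexp, PMF.fexp, Finset.mul_sum]
        refine Finset.sum_le_sum fun y _ => ?_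
        rw [mul_left_comm]
        refine mul_le_mul_of_nonneg_left ?_ ENNReal.toReal_nonneg
        split_ifs with hxy
        · simp [hxy]
        · simpa using hdist y x
      · have e1 : (⟨s + 1, hs⟩ : Fin (n + 1)) = (⟨s + 1, hlt⟩ : Fin n).castSucc := rfl
        have e2 : (⟨s, Nat.lt_of_succ_lt hs⟩ : Fin (n + 1)) =
          (⟨s, Nat.lt_of_succ_lt hlt⟩ : Fin n).castSucc := rfl
        simp only [e1, e2, Fin.snoc_castSucc, PMF.fexp_const]
        exact ih _ s hlt
  refine ⟨A, fun l t₀ k h => ?_⟩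
  change (A.law l T le_rfl).fexp (fun i => ∑ t ∈ interval T t₀ k, (l t).val (i t) +
    ∑ t ∈ intervalTail T t₀ k, dist (i t) (i (prevStep t))) ≤ _
  rw [PMF.fexp_add, PMF.fexp_sum, PMF.fexp_sum, Finset.sum_add_distrib]
  refine add_le_add (le_of_eq ?_) ?_
  · rw [← sum_interval h (fun t => ∑ x, p (padLoss l) t x * padLoss l t x)]
    refine Finset.sum_congr rfl fun t _ => ?_
    rw [hmarg l T le_rfl t (fun x => (l t).val x), padLoss_val]
  · refine le_trans ?_ (sum_intervalTail_le h (fun t => Metric.diam (Set.univ : Set X) *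
      ∑ x, max (p (padLoss l) t x - p (padLoss l) (t + 1) x) 0) fun n =>
        mul_nonneg Metric.diam_nonneg (Finset.sum_nonneg fun _ _ => le_max_right _ _))
    refine Finset.sum_le_sum fun t ht => ?_
    simp only [intervalTail, Finset.mem_filter, Finset.mem_univ, true_and] at ht
    obtain ⟨t, htT⟩ := t
    obtain ⟨s, rfl⟩ : ∃ s, t = s + 1 := ⟨t - 1, by simp only at ht; omega⟩
    exact hpair l T le_rfl s htT

end MetricalTaskSystem

/-! ### Multiplicative weights with expert-dependent rates. -/

namespace MetricalTaskSystem

section Weights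

variable {E : Type*} [Fintype E]

/-- The distribution played with weights `w` and learning rates `η`. -/
noncomputable def play (η w : E → ℝ) (e : E) : ℝ := η e * w e / ∑ e', η e' * w e'

/-- The excess of the average loss over the loss of expert `e`. -/
noncomputable def excess (η w ℓ : E → ℝ) (e : E) : ℝ := ∑ e', play η w e' * ℓ e' - ℓ e

/-- The multiplicative update of the weights, mixed with the uniform distribution. -/
noncomputable def update (η : E → ℝ) (α : ℝ) (w ℓ : E → ℝ) (e : E) : ℝ :=
  (1 - α) * (w e * (1 + η e * excess η w ℓ e)) + α / Fintype.card E

/-- The weights after the first `n` rounds. -/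
noncomputable def weights (η : E → ℝ) (α : ℝ) (ℓ : ℕ → E → ℝ) : ℕ → E → ℝ
  | 0 => fun _ => 1 / Fintype.card E
  | n + 1 => update η α (weights η α ℓ n) (ℓ n)

lemma weights_congr (η : E → ℝ) (α : ℝ) {ℓ ℓ' : ℕ → E → ℝ} {n : ℕ} (h : ∀ s < n, ℓ s = ℓ' s) :
    weights η α ℓ n = weights η α ℓ' n := by
  induction n with
  | zero => rfl
  | succ n ih =>
    rw [weights, weights, ih fun s hs => h s (hs.trans n.lt_succ_self), h n n.lt_succ_self]

variable {η w ℓ : E → ℝ} {α lo hi : ℝ}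

lemma rate_mass_pos [Nonempty E] (hη : ∀ e, 0 < η e) (hw : ∀ e, 0 < w e) :
    0 < ∑ e, η e * w e :=
  Finset.sum_pos (fun e _ => mul_pos (hη e) (hw e)) Finset.univ_nonempty

lemma play_nonneg (hη : ∀ e, 0 < η e) (hw : ∀ e, 0 < w e) (e : E) : 0 ≤ play η w e :=
  div_nonneg (mul_pos (hη e) (hw e)).le (Finset.sum_nonneg fun e _ => (mul_pos (hη e) (hw e)).le)

lemma sum_play [Nonempty E] (hη : ∀ e, 0 < η e) (hw : ∀ e, 0 < w e) : ∑ e, play η w e = 1 := by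
  simp only [play]
  rw [← Finset.sum_div, div_self (rate_mass_pos hη hw).ne']

lemma sum_play_mul_mem_Icc [Nonempty E] {a b : ℝ} (hη : ∀ e, 0 < η e) (hw : ∀ e, 0 < w e)
    {f : E → ℝ} (hf : ∀ e, f e ∈ Set.Icc a b) : ∑ e, play η w e * f e ∈ Set.Icc a b := by
  have h1 := sum_play hη hw
  constructor
  · calc a = ∑ e, play η w e * a := by rw [← Finset.sum_mul, h1, one_mul]
      _ ≤ _ := Finset.sum_le_sum fun e _ =>
        mul_le_mul_of_nonneg_left (hf e).1 (play_nonneg hη hw e)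
  · calc _ ≤ ∑ e, play η w e * b := Finset.sum_le_sum fun e _ =>
        mul_le_mul_of_nonneg_left (hf e).2 (play_nonneg hη hw e)
      _ = b := by rw [← Finset.sum_mul, h1, one_mul]

lemma abs_excess_le [Nonempty E] (hη : ∀ e, 0 < η e) (hw : ∀ e, 0 < w e)
    (hℓ : ∀ e, ℓ e ∈ Set.Icc (0 : ℝ) 2) (e : E) : |excess η w ℓ e| ≤ 2 := by
  have h := sum_play_mul_mem_Icc hη hw hℓ
  have := hℓ e
  rw [excess, abs_le]
  constructor <;> linarith [h.1, h.2, this.1, this.2]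

/-- Since `η e * w e` is proportional to `play η w e`, this is the mean deviation of the loss from
its own mean. It is why the update conserves mass. -/
lemma sum_mul_excess [Nonempty E] (hη : ∀ e, 0 < η e) (hw : ∀ e, 0 < w e) :
    ∑ e, w e * (η e * excess η w ℓ e) = 0 := by
  have hZ := rate_mass_pos hη hw
  have : ∀ e, w e * (η e * excess η w ℓ e) = (∑ e', η e' * w e') *
      (play η w e * ∑ e', play η w e' * ℓ e' - play η w e * ℓ e) := fun e => by
    rw [excess, ← mul_sub, ← mul_assoc _ (play η w e), play, mul_div_cancel₀ _ hZ.ne']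
    ring
  simp only [this]
  rw [← Finset.mul_sum, Finset.sum_sub_distrib, ← Finset.sum_mul, sum_play hη hw]
  simp

lemma abs_rate_mul_excess_le [Nonempty E] (hη : ∀ e, 0 < η e) (hη6 : ∀ e, η e ≤ 1 / 6)
    (hw : ∀ e, 0 < w e) (hℓ : ∀ e, ℓ e ∈ Set.Icc (0 : ℝ) 2) (e : E) :
    |η e * excess η w ℓ e| ≤ 2 * η e ∧ |η e * excess η w ℓ e| ≤ 1 / 3 := by
  have h := abs_excess_le hη hw hℓ e
  have : |η e * excess η w ℓ e| ≤ 2 * η e := by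
    rw [abs_mul, abs_of_pos (hη e), mul_comm]
    exact mul_le_mul_of_nonneg_right h (hη e).le
  exact ⟨this, by linarith [hη6 e]⟩

lemma sum_update [Nonempty E] (hη : ∀ e, 0 < η e) (hw : ∀ e, 0 < w e) (hw1 : ∑ e, w e = 1) :
    ∑ e, update η α w ℓ e = 1 := by
  simp only [update, mul_add, mul_one]
  rw [Finset.sum_add_distrib, Finset.sum_add_distrib, ← Finset.mul_sum, ← Finset.mul_sum,
    sum_mul_excess hη hw, hw1]
  simp
  field_simp
  ring

lemma le_update [Nonempty E] (hη : ∀ e, 0 < η e) (hη6 : ∀ e, η e ≤ 1 / 6)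
    (hw : ∀ e, 0 < w e) (hℓ : ∀ e, ℓ e ∈ Set.Icc (0 : ℝ) 2) (hα1 : α ≤ 1 / 2) (e : E) :
    α / Fintype.card E ≤ update η α w ℓ e := by
  have h := (abs_le.1 (abs_rate_mul_excess_le hη hη6 hw hℓ e).2).1
  have : 0 ≤ (1 - α) * (w e * (1 + η e * excess η w ℓ e)) :=
    mul_nonneg (by linarith) (mul_nonneg (hw e).le (by linarith))
  rw [update]
  linarith

lemma weights_spec [Nonempty E] (hη : ∀ e, 0 < η e) (hη6 : ∀ e, η e ≤ 1 / 6) (hα : 0 < α)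
    (hα1 : α ≤ 1 / 2) {ℓ : ℕ → E → ℝ} (hℓ : ∀ n e, ℓ n e ∈ Set.Icc (0 : ℝ) 2) (n : ℕ) :
    (∀ e, α / Fintype.card E ≤ weights η α ℓ n e) ∧ (∀ e, 0 < weights η α ℓ n e) ∧
      ∑ e, weights η α ℓ n e = 1 := by
  have hc : (0 : ℝ) < Fintype.card E := by exact_mod_cast Fintype.card_pos
  have key : ∀ n, (∀ e, α / Fintype.card E ≤ weights η α ℓ n e) ∧
      ∑ e, weights η α ℓ n e = 1 := fun n => by
    induction n with
    | zero =>
      refine ⟨fun e => div_le_div_of_nonneg_right (by linarith) hc.le, ?_⟩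
      simp [weights]
    | succ n ih =>
      have hw : ∀ e, 0 < weights η α ℓ n e := fun e => (div_pos hα hc).trans_le (ih.1 e)
      exact ⟨le_update hη hη6 hw (hℓ n) hα1, sum_update hη hw ih.2⟩
  exact ⟨(key n).1, fun e => (div_pos hα hc).trans_le ((key n).1 e), (key n).2⟩

/-- The total variation distance between consecutive plays is at most a multiple of the average
learning rate. -/
lemma sum_max_play_sub_le [Nonempty E] (hlo : 0 < lo) (hηlo : ∀ e, lo ≤ η e)
    (hηhi : ∀ e, η e ≤ hi) (hhi : hi ≤ 1 / 6) (hw : ∀ e, 0 < w e) (hw1 : ∑ e, w e = 1)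
    (hℓ : ∀ e, ℓ e ∈ Set.Icc (0 : ℝ) 2) (hα : 0 < α) (hα1 : α ≤ 1 / 2) (hαη : α * hi ≤ lo ^ 2) :
    ∑ e, max (play η w e - play η (update η α w ℓ) e) 0 ≤ 6 * ∑ e, play η w e * η e := by
  have hη : ∀ e, 0 < η e := fun e => hlo.trans_le (hηlo e)
  have hη6 : ∀ e, η e ≤ 1 / 6 := fun e => (hηhi e).trans hhi
  have hc : (0 : ℝ) < Fintype.card E := by exact_mod_cast Fintype.card_pos
  have hZ := rate_mass_pos hη hw
  have hw' : ∀ e, 0 < update η α w ℓ e := fun e =>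
    (div_pos hα hc).trans_le (le_update hη hη6 hw hℓ hα1 e)
  have hZ' := rate_mass_pos hη hw'
  have hr := fun e => (abs_rate_mul_excess_le hη hη6 hw hℓ e).1
  have hq := play_nonneg hη hw
  have hq1 := sum_play hη hw
  have hZlo : lo ≤ ∑ e, η e * w e := by
    calc lo = ∑ e, lo * w e := by rw [← Finset.mul_sum, hw1, mul_one]
      _ ≤ _ := Finset.sum_le_sum fun e _ => mul_le_mul_of_nonneg_right (hηlo e) (hw e).le
  have havg : lo ≤ ∑ e, play η w e * η e := (sum_play_mul_mem_Icc hη hw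
    fun e => ⟨hηlo e, hηhi e⟩).1
  have hZq : ∀ e, η e * w e = (∑ e, η e * w e) * play η w e := fun e => by
    rw [play, mul_div_cancel₀ _ hZ.ne']
  have hαlo : α ≤ lo := by
    have e0 := Classical.arbitrary E
    have h1 : lo ≤ hi := (hηlo e0).trans (hηhi e0)
    have h2 : α * lo ≤ lo * lo := by nlinarith
    exact le_of_mul_le_mul_right h2 hlo
  generalize hA : ∑ e, play η w e * η e = a at *
  -- The normalizer grows by a factor of at most `1 + 2a` from the update; mixing adds at most `α *
  -- hi ≤ lo ^ 2`, which is `lo` times the normalizer at most.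
  have hup : ∑ e, η e * update η α w ℓ e ≤ (∑ e, η e * w e) * (1 + 2 * a + lo) := by
    have h1 : ∀ e, η e * update η α w ℓ e ≤
        (η e * w e + (∑ e, η e * w e) * (2 * (play η w e * η e))) + α * hi / Fintype.card E := by
      intro e
      have h2 : w e * (1 + η e * excess η w ℓ e) ≤ w e * (1 + 2 * η e) :=
        mul_le_mul_of_nonneg_left (by linarith [(abs_le.1 (hr e)).2]) (hw e).le
      have h3 : 0 ≤ w e * (1 + 2 * η e) := mul_nonneg (hw e).le (by linarith [hη e])
      have h4 : (1 - α) * (w e * (1 + η e * excess η w ℓ e)) ≤ w e * (1 + 2 * η e) := by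
        nlinarith
      have h5 : η e * (α / Fintype.card E) ≤ hi * (α / Fintype.card E) :=
        mul_le_mul_of_nonneg_right (hηhi e) (div_pos hα hc).le
      have h6 : (∑ e, η e * w e) * (2 * (play η w e * η e)) = 2 * (η e * w e) * η e := by
        rw [hZq e]; ring
      have h7 := mul_le_mul_of_nonneg_left h4 (hη e).le
      rw [h6, update, mul_add]
      calc _ ≤ η e * (w e * (1 + 2 * η e)) + hi * (α / Fintype.card E) := add_le_add h7 h5
        _ = _ := by ring
    refine (Finset.sum_le_sum fun e _ => h1 e).trans ?_
    rw [Finset.sum_add_distrib, Finset.sum_add_distrib, ← Finset.mul_sum, ← Finset.mul_sum, hA]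
    simp only [Finset.sum_const, Finset.card_univ, nsmul_eq_mul]
    rw [mul_div_cancel₀ _ hc.ne']
    nlinarith
  have hlow : ∀ e, play η w e * (1 - α - 2 * η e - 2 * a - lo) ≤
      play η (update η α w ℓ) e := by
    intro e
    have h1 : (1 - α) * (w e * (1 - 2 * η e)) ≤ update η α w ℓ e := by
      have h2 : w e * (1 - 2 * η e) ≤ w e * (1 + η e * excess η w ℓ e) :=
        mul_le_mul_of_nonneg_left (by linarith [(abs_le.1 (hr e)).1]) (hw e).le
      have := mul_le_mul_of_nonneg_left h2 (by linarith : 0 ≤ 1 - α)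
      have := div_pos hα hc
      rw [update]
      linarith
    rw [play.eq_1 η (update η α w ℓ), le_div_iff₀ hZ']
    have h2 := mul_le_mul_of_nonneg_left h1 (hη e).le
    refine le_trans ?_ h2
    have h3 : η e * ((1 - α) * (w e * (1 - 2 * η e))) =
        play η w e * ((∑ e, η e * w e) * ((1 - α) * (1 - 2 * η e))) := by
      have := hZq e
      calc _ = (η e * w e) * ((1 - α) * (1 - 2 * η e)) := by ring
        _ = _ := by rw [this]; ring
    rw [h3, mul_assoc]
    refine mul_le_mul_of_nonneg_left ?_ (hq e)
    have hηe := hη e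
    have hηe6 := hη6 e
    -- If the factor is negative the bound is trivial; multiplying by `hup` needs it nonnegative.
    rcases le_total 0 (1 - α - 2 * η e - 2 * a - lo) with hs | hs
    · calc _ ≤ (1 - α - 2 * η e - 2 * a - lo) * ((∑ e, η e * w e) * (1 + 2 * a + lo)) :=
            mul_le_mul_of_nonneg_left hup hs
        _ = (∑ e, η e * w e) * ((1 - α - 2 * η e - 2 * a - lo) * (1 + 2 * a + lo)) := by ring
        _ ≤ _ := by
          refine mul_le_mul_of_nonneg_left ?_ hZ.le
          have : 0 ≤ (2 * a + lo) * (2 * a + lo + α + 2 * η e) := by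
            have : 0 < a := hlo.trans_le havg
            positivity
          have : 0 ≤ α * (2 * η e) := by positivity
          nlinarith
    · refine (mul_nonpos_of_nonpos_of_nonneg hs hZ'.le).trans ?_
      exact mul_nonneg hZ.le (mul_nonneg (by linarith) (by linarith))
  have hbound : ∀ e, max (play η w e - play η (update η α w ℓ) e) 0 ≤
      play η w e * (α + 2 * a + lo) + 2 * (play η w e * η e) := by
    intro e
    have : 0 < a := hlo.trans_le havg
    have := hq e
    have := hη e
    refine max_le ?_ (by positivity)
    have := hlow e
    nlinarith
  -- The total is `α + 4 * a + lo`, and `α ≤ lo ≤ a` gives the constant 6.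
  refine (Finset.sum_le_sum fun e _ => hbound e).trans ?_
  rw [Finset.sum_add_distrib, ← Finset.sum_mul, ← Finset.mul_sum, hq1, hA]
  linarith

lemma sub_two_mul_sq_le_log {y : ℝ} (hy : -(1 / 2) ≤ y) : y - 2 * y ^ 2 ≤ Real.log (1 + y) := by
  have h1 : 0 < 1 + y := by linarith
  refine le_trans ?_ (Real.one_sub_inv_le_log_of_pos h1)
  have : 1 - (1 + y)⁻¹ - (y - 2 * y ^ 2) = y ^ 2 * (1 + 2 * y) / (1 + y) := by
    field_simp
    ring
  have : 0 ≤ y ^ 2 * (1 + 2 * y) / (1 + y) :=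
    div_nonneg (mul_nonneg (sq_nonneg y) (by linarith)) h1.le
  linarith

/-- Regret of the weights algorithm against one expert, on an arbitrary interval. -/
lemma sum_excess_le [Nonempty E] (hη : ∀ e, 0 < η e) (hη6 : ∀ e, η e ≤ 1 / 6) (hα : 0 < α)
    (hα1 : α ≤ 1 / 2) {ℓ : ℕ → E → ℝ} (hℓ : ∀ n e, ℓ n e ∈ Set.Icc (0 : ℝ) 2) (e : E)
    (t₀ k : ℕ) :
    ∑ i ∈ Finset.range k, excess η (weights η α ℓ (t₀ + i)) (ℓ (t₀ + i)) e ≤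
      8 * η e * k + (Real.log (Fintype.card E / α) + 2 * α * k) / η e := by
  have hc : (0 : ℝ) < Fintype.card E := by exact_mod_cast Fintype.card_pos
  have hspec := weights_spec hη hη6 hα hα1 hℓ
  -- Potential argument: `8 * η ^ 2` bounds `2 * y ^ 2` because `|y| ≤ 2 * η`, and `2 * α` bounds
  -- the loss from `log (1 - α)`.
  have hstep : ∀ n, Real.log (weights η α ℓ n e) +
      (η e * excess η (weights η α ℓ n) (ℓ n) e - 8 * η e ^ 2 - 2 * α) ≤
        Real.log (weights η α ℓ (n + 1) e) := fun n => by
    have hw := (hspec n).2.1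
    obtain ⟨h1, h2⟩ := abs_rate_mul_excess_le hη hη6 hw (hℓ n) e
    generalize hy : η e * excess η (weights η α ℓ n) (ℓ n) e = y at *
    have hy3 := (abs_le.1 h2).1
    have hle : (1 - α) * (weights η α ℓ n e * (1 + y)) ≤ weights η α ℓ (n + 1) e := by
      rw [weights, update, hy]
      linarith [div_pos hα hc]
    have hαp : 0 < 1 - α := by linarith
    have hyp : 0 < 1 + y := by linarith
    have hlog := Real.log_le_log (mul_pos hαp (mul_pos (hw e) hyp)) hle
    rw [Real.log_mul hαp.ne' (mul_pos (hw e) hyp).ne', Real.log_mul (hw e).ne' hyp.ne'] at hlog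
    have hl1 := sub_two_mul_sq_le_log (y := y) (by linarith)
    have hl2 := sub_two_mul_sq_le_log (y := -α) (by linarith)
    have hysq : y ^ 2 ≤ (2 * η e) ^ 2 := sq_le_sq' (by linarith [(abs_le.1 h1).1])
      (abs_le.1 h1).2
    have hl3 : -(2 * α) ≤ Real.log (1 - α) := by
      rw [sub_eq_add_neg]
      nlinarith
    linarith
  have hsum : Real.log (weights η α ℓ t₀ e) + ∑ i ∈ Finset.range k,
      (η e * excess η (weights η α ℓ (t₀ + i)) (ℓ (t₀ + i)) e - 8 * η e ^ 2 - 2 * α) ≤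
        Real.log (weights η α ℓ (t₀ + k) e) := by
    induction k with
    | zero => simp
    | succ k ih =>
      rw [Finset.sum_range_succ, ← add_assoc t₀]
      linarith [hstep (t₀ + k)]
  have hend : Real.log (weights η α ℓ (t₀ + k) e) ≤ 0 := by
    refine Real.log_nonpos ((hspec _).2.1 e).le ?_
    rw [← (hspec (t₀ + k)).2.2]
    exact Finset.single_le_sum (f := weights η α ℓ (t₀ + k))
      (fun e _ => ((hspec _).2.1 e).le) (Finset.mem_univ e)
  -- The floor on weights lets the interval start at any `t₀`.
  have hstart : -Real.log (Fintype.card E / α) ≤ Real.log (weights η α ℓ t₀ e) := by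
    rw [← Real.log_inv, inv_div]
    exact Real.log_le_log (div_pos hα hc) ((hspec t₀).1 e)
  simp only [Finset.sum_sub_distrib, ← Finset.mul_sum, Finset.sum_const, Finset.card_range,
    nsmul_eq_mul] at hsum
  have h := hη e
  have : 8 * η e * k + (Real.log (Fintype.card E / α) + 2 * α * k) / η e =
      (8 * η e ^ 2 * k + Real.log (Fintype.card E / α) + 2 * α * k) / η e := by
    field_simp
    ring
  rw [this, le_div_iff₀ h]
  linarith

end Weights

end MetricalTaskSystem

/-! ### Surrogate losses and tuning of the rates. -/

namespace MetricalTaskSystem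

section Regret

variable {X : Type*} [PseudoMetricSpace X] [Fintype X] [Nonempty X]

lemma bestFixed_add_le {M : MetricalTaskSystem X} {T t₀ k : ℕ} (h : t₀ + k ≤ T)
    (l : Fin T → M.losses) {a R : ℝ}
    (ha : ∀ x, a ≤ ∑ i ∈ Finset.range k, padLoss l (t₀ + i) x + R) :
    a ≤ bestFixed l t₀ k + R := by
  rw [← sub_le_iff_le_add, bestFixed, Finset.le_inf'_iff]
  intro x _
  have h2 := sum_interval h fun t => padLoss l t x
  simp only [padLoss_val] at h2
  rw [h2, sub_le_iff_le_add]
  exact ha x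

lemma exists_constant_algorithm (M : MetricalTaskSystem X) (T : ℕ) (x : X) :
    ∃ A : M.OnlineAlgorithm T, ∀ (l : Fin T → M.losses) (t₀ k : ℕ), t₀ + k ≤ T →
      A.expect l (cost l t₀ k) ≤ ∑ i ∈ Finset.range k, padLoss l (t₀ + i) x := by
  classical
  obtain ⟨A, hA⟩ := exists_algorithm M T (fun _ _ y => if y = x then 1 else 0)
    (fun _ _ _ _ => rfl) (fun _ _ y => by split_ifs <;> norm_num) (fun _ _ => by simp)
  refine ⟨A, fun l t₀ k h => (hA l t₀ k h).trans (le_of_eq ?_)⟩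
  simp

/-- A single algorithm which, on each interval, competes with each fixed state at each of the
learning rates `1 / (6 (D + 1) (j + 1))`. -/
theorem exists_multirate_algorithm (M : MetricalTaskSystem X) (T : ℕ) :
    ∃ A : M.OnlineAlgorithm T, ∀ (l : Fin T → M.losses) (t₀ k : ℕ), t₀ + k ≤ T →
      A.expect l (cost l t₀ k) ≤ 2 * k ∧ ∀ (x : X) (m : ℕ), 0 < m → m ≤ T + 1 →
        A.expect l (cost l t₀ k) ≤ ∑ i ∈ Finset.range k, padLoss l (t₀ + i) x + (3 * k / m +
          6 * (Metric.diam (Set.univ : Set X) + 1) * m *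
            (Real.log (6 * (Metric.diam (Set.univ : Set X) + 1) * Fintype.card X *
              (T + 1) ^ 3) + 1)) := by
  set D : ℝ := Metric.diam (Set.univ : Set X) with hD
  have hD0 : 0 ≤ D := Metric.diam_nonneg
  have hT0 : (0 : ℝ) ≤ T := Nat.cast_nonneg T
  let E := Fin (T + 1) × X
  let η : E → ℝ := fun e => 1 / (6 * (D + 1) * ((e.1 : ℕ) + 1))
  let γ : E → ℝ := fun e => 1 / ((e.1 : ℕ) + 1)
  -- `γ = 6 * (D + 1) * η` prepays the movement; as `γ ≤ 1`, surrogate losses lie in `[0, 2]`.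
  let ℓ : (ℕ → X → ℝ) → ℕ → E → ℝ := fun l n e => l n e.2 + γ e
  set hi : ℝ := 1 / (6 * (D + 1)) with hhi
  set lo : ℝ := hi / (T + 1) with hlo
  -- Makes `α * hi = lo ^ 2`, as the movement bound requires, and keeps `2 * α * k ≤ 1`.
  set α : ℝ := hi / (T + 1) ^ 2 with hα
  let w : (ℕ → X → ℝ) → ℕ → E → ℝ := fun l => weights η α (ℓ l)
  have hhi0 : 0 < hi := by positivity
  have hlo0 : 0 < lo := by positivity
  have hα0 : 0 < α := by positivity
  have hhi6 : hi ≤ 1 / 6 := one_div_le_one_div_of_le (by norm_num) (by linarith)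
  have hαhi : α ≤ hi := div_le_self hhi0.le (one_le_pow₀ (by linarith))
  have hα1 : α ≤ 1 / 2 := by linarith
  have hγη : ∀ e, γ e = 6 * (D + 1) * η e := fun e => by
    simp only [γ, η]; field_simp
  have hηγ : ∀ e, η e = hi * γ e := fun e => by
    simp only [γ, η, hhi]; field_simp
  have hγ0 : ∀ e, 0 < γ e := fun e => by simp only [γ]; positivity
  have hγ1 : ∀ e, γ e ≤ 1 := fun e => by
    simp only [γ]
    exact div_le_one_of_le₀ (by linarith [Nat.cast_nonneg (α := ℝ) (e.1 : ℕ)]) (by positivity)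
  have hη0 : ∀ e, 0 < η e := fun e => by rw [hηγ]; exact mul_pos hhi0 (hγ0 e)
  have hηhi : ∀ e, η e ≤ hi := fun e => by
    rw [hηγ]; exact mul_le_of_le_one_right hhi0.le (hγ1 e)
  have hηlo : ∀ e, lo ≤ η e := fun e => by
    rw [hηγ, hlo, div_eq_mul_one_div]
    refine mul_le_mul_of_nonneg_left (one_div_le_one_div_of_le (by positivity) ?_) hhi0.le
    have : ((e.1 : ℕ) : ℝ) ≤ T := by exact_mod_cast Nat.lt_succ_iff.1 e.1.2
    linarith
  have hη6 : ∀ e, η e ≤ 1 / 6 := fun e => (hηhi e).trans hhi6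
  have hαη : α * hi ≤ lo ^ 2 := le_of_eq (by rw [hα, hlo, div_pow]; ring)
  have hℓ : ∀ (l : Fin T → M.losses) n e, ℓ (padLoss l) n e ∈ Set.Icc (0 : ℝ) 2 :=
    fun l n e => by
      have h := padLoss_mem_Icc l n e.2
      have h0 := hγ0 e
      have h1 := hγ1 e
      constructor <;> simp only [ℓ] <;> linarith [h.1, h.2]
  have hw : ∀ (l : Fin T → M.losses) n, (∀ e, 0 < w (padLoss l) n e) ∧
      ∑ e, w (padLoss l) n e = 1 := fun l n =>
    (weights_spec hη0 hη6 hα0 hα1 (hℓ l) n).2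
  obtain ⟨A, hA⟩ := exists_algorithm M T (fun l n x => ∑ j, play η (w l n) (j, x))
    (fun l l' n h => by
      have : w l n = w l' n := weights_congr η α fun s hs => by
        funext e
        simp only [ℓ, h s hs]
      simp only [this])
    (fun l n x => Finset.sum_nonneg fun j _ => play_nonneg hη0 (hw l n).1 _)
    (fun l n => by
      rw [Finset.sum_comm, ← Fintype.sum_prod_type (f := fun e : E => play η (w (padLoss l) n) e)]
      exact sum_play hη0 (hw l n).1)
  have hround : ∀ (l : Fin T → M.losses) n,
      ∑ x, (∑ j, play η (w (padLoss l) n) (j, x)) * padLoss l n x +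
        D * ∑ x, max (∑ j, play η (w (padLoss l) n) (j, x) -
          ∑ j, play η (w (padLoss l) (n + 1)) (j, x)) 0 ≤
      ∑ e, play η (w (padLoss l) n) e * ℓ (padLoss l) n e := fun l n => by
    have h1 : ∑ x, (∑ j, play η (w (padLoss l) n) (j, x)) * padLoss l n x =
        ∑ e : E, play η (w (padLoss l) n) e * padLoss l n e.2 := by
      rw [Fintype.sum_prod_type, Finset.sum_comm]
      simp only [Finset.sum_mul]
    -- Forgetting the rate index does not increase total variation.
    have h2 : ∑ x, max (∑ j, play η (w (padLoss l) n) (j, x) -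
          ∑ j, play η (w (padLoss l) (n + 1)) (j, x)) 0 ≤
        ∑ e : E, max (play η (w (padLoss l) n) e - play η (w (padLoss l) (n + 1)) e) 0 := by
      rw [Fintype.sum_prod_type, Finset.sum_comm]
      refine Finset.sum_le_sum fun x _ => max_le ?_ (Finset.sum_nonneg fun _ _ => le_max_right _ _)
      rw [← Finset.sum_sub_distrib]
      exact Finset.sum_le_sum fun _ _ => le_max_left _ _
    have h3 := sum_max_play_sub_le hlo0 hηlo hηhi hhi6 (hw l n).1 (hw l n).2 (hℓ l n) hα0 hα1 hαη
    have h4 : ∑ e, play η (w (padLoss l) n) e * ℓ (padLoss l) n e =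
        ∑ e : E, play η (w (padLoss l) n) e * padLoss l n e.2 +
          (D + 1) * (6 * ∑ e, play η (w (padLoss l) n) e * η e) := by
      simp only [ℓ, hγη, mul_add, Finset.sum_add_distrib, Finset.mul_sum]
      congr 2
      funext e
      ring
    rw [h1, h4]
    have h5 := h2.trans h3
    have h6 : 0 ≤ 6 * ∑ e, play η (w (padLoss l) n) e * η e :=
      mul_nonneg (by norm_num) (Finset.sum_nonneg fun e _ =>
        mul_nonneg (play_nonneg hη0 (hw l n).1 e) (hη0 e).le)
    have h7 := mul_le_mul_of_nonneg_left h5 hD0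
    linarith
  have hcost : ∀ (l : Fin T → M.losses) (t₀ k : ℕ), t₀ + k ≤ T →
      A.expect l (cost l t₀ k) ≤ ∑ i ∈ Finset.range k,
        ∑ e, play η (w (padLoss l) (t₀ + i)) e * ℓ (padLoss l) (t₀ + i) e :=
    fun l t₀ k h => (hA l t₀ k h).trans (Finset.sum_le_sum fun i _ => hround l (t₀ + i))
  refine ⟨A, fun l t₀ k h => ⟨(hcost l t₀ k h).trans ?_, fun x m hm0 hm => ?_⟩⟩
  · calc _ ≤ ∑ i ∈ Finset.range k, (2 : ℝ) := Finset.sum_le_sum fun i _ =>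
        (sum_play_mul_mem_Icc hη0 (hw l _).1 (hℓ l _)).2
      _ = 2 * k := by simp [mul_comm]
  · refine (hcost l t₀ k h).trans ?_
    have hm' : (0 : ℝ) < m := by exact_mod_cast hm0
    let e : E := (⟨m - 1, by omega⟩, x)
    have hem : (((e.1 : ℕ) : ℝ) + 1) = m := by
      have : (e.1 : ℕ) + 1 = m := by simp only [e]; omega
      exact_mod_cast this
    have hγe : γ e = 1 / m := by simp only [γ, hem]
    have hηe : η e = 1 / (6 * (D + 1) * m) := by simp only [η, hem]
    have hreg := sum_excess_le hη0 hη6 hα0 hα1 (hℓ l) e t₀ k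
    have hkey : ∀ i, ∑ e, play η (w (padLoss l) (t₀ + i)) e * ℓ (padLoss l) (t₀ + i) e =
        excess η (w (padLoss l) (t₀ + i)) (ℓ (padLoss l) (t₀ + i)) e +
          (padLoss l (t₀ + i) x + 1 / m) := fun i => by
      rw [← hγe, excess]
      exact (sub_add_cancel _ _).symm
    simp only [hkey]
    rw [Finset.sum_add_distrib, Finset.sum_add_distrib]
    simp only [Finset.sum_const, Finset.card_range, nsmul_eq_mul]
    have hlog : (Fintype.card E : ℝ) / α = 6 * (D + 1) * Fintype.card X * (T + 1) ^ 3 := by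
      simp only [E, Fintype.card_prod, Fintype.card_fin, hα, hhi]
      push_cast
      field_simp
    rw [hlog] at hreg
    have hkT : (k : ℝ) ≤ T := by exact_mod_cast (Nat.le_add_left k t₀).trans h
    have hαk : 2 * α * k ≤ 1 := by
      have h1 : α * (T + 1) ≤ hi := by
        rw [hα, div_mul_eq_mul_div, div_le_iff₀ (by positivity)]
        exact mul_le_mul_of_nonneg_left (le_self_pow₀ (by linarith) two_ne_zero) hhi0.le
      nlinarith
    -- Together with `k / m` from the surrogate term `γ e`, this makes `3 * k / m`.
    have hη8 : 8 * η e * k ≤ 2 * (k / m) := by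
      have h1 : η e ≤ 1 / 6 * (1 / m) := by
        rw [hηγ, hγe]
        exact mul_le_mul_of_nonneg_right hhi6 (by positivity)
      have h2 : (k : ℝ) / m = k * (1 / m) := by ring
      have h3 : (0 : ℝ) ≤ 1 / m := by positivity
      have h4 : (0 : ℝ) ≤ k := Nat.cast_nonneg k
      rw [h2]
      nlinarith [mul_le_mul_of_nonneg_left h1 h4, mul_nonneg h3 h4]
    have hdiv : ∀ a, a / η e = 6 * (D + 1) * m * a := fun a => by rw [hηe]; field_simp
    rw [hdiv] at hreg
    have h5 : 6 * (D + 1) * m * (Real.log (6 * (D + 1) * Fintype.card X * (T + 1) ^ 3) +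
        2 * α * k) ≤ 6 * (D + 1) * m *
          (Real.log (6 * (D + 1) * Fintype.card X * (T + 1) ^ 3) + 1) :=
      mul_le_mul_of_nonneg_left (by linarith) (by positivity)
    have h6 : (k : ℝ) * (1 / m) = k / m := by ring
    have h7 : 3 * (k : ℝ) / m = 3 * (k / m) := by ring
    rw [h6, h7]
    linarith

/-- If `D + 1 ≤ 2 T` and `2 ≤ N`, the logarithmic term of the regret is a multiple of
`log (N T)`. -/
lemma log_le_mul_log {D N T : ℝ} (hD : 0 ≤ D) (hN : 2 ≤ N) (hT : 1 ≤ T) (hDT : D + 1 ≤ 2 * T) :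
    Real.log (6 * (D + 1) * N * (T + 1) ^ 3) + 1 ≤ 13 * Real.log (N * T) := by
  have hNT : 2 ≤ N * T := by nlinarith
  have h1 : (T + 1) ^ 3 ≤ (2 * T) ^ 3 := pow_le_pow_left₀ (by linarith) (by linarith) 3
  have h2 : 6 * (D + 1) * N * (T + 1) ^ 3 ≤ (N * T) ^ 11 := by
    calc 6 * (D + 1) * N * (T + 1) ^ 3 ≤ 6 * (2 * T) * N * (2 * T) ^ 3 := by gcongr
      _ = 96 * T ^ 3 * (N * T) := by ring
      _ ≤ 2 ^ 7 * (N * T) ^ 3 * (N * T) := by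
        have : T ^ 3 ≤ (N * T) ^ 3 := pow_le_pow_left₀ (by linarith) (by nlinarith) 3
        gcongr
        norm_num
      _ ≤ (N * T) ^ 7 * (N * T) ^ 3 * (N * T) := by gcongr
      _ = (N * T) ^ 11 := by ring
  have h3 := Real.log_le_log (by positivity) h2
  rw [Real.log_pow] at h3
  have h4 := Real.log_le_log (by norm_num) hNT
  have h5 := Real.log_two_gt_d9
  push_cast at h3
  -- `13 = 11 + 2`: the extra `1` is at most `2 * log 2 ≤ 2 * log (N * T)`.
  linarith

lemma le_sqrt_mul {a k : ℝ} (hk : 0 ≤ k) (h : k ≤ a) : k ≤ Real.sqrt (a * k) :=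
  Real.le_sqrt_of_sq_le (by nlinarith)

end Regret

end MetricalTaskSystem

theorem mainTheorem6 :
    ∃ C : ℝ, 0 < C ∧
      ∀ (X : Type*) [PseudoMetricSpace X] [Fintype X] [Nonempty X]
        (M : MetricalTaskSystem X) (T : ℕ),
        ∃ A : M.OnlineAlgorithm T, ∀ t₀ k : ℕ, t₀ + k ≤ T →
          A.HasRegretBound t₀ k
            (C * Real.sqrt ((Metric.diam (Set.univ : Set X) + 1) * (k : ℝ) *
              Real.log ((Fintype.card X : ℝ) * (T : ℝ)))) := by
  -- `159 = 3 + 156`, with `156 = 6 * 2 * 13` from `⌈s⌉₊ ≤ 2 * s` and `log_le_mul_log`.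
  refine ⟨159, by norm_num, fun X _ _ _ M T => ?_⟩
  have hD0 : 0 ≤ Metric.diam (Set.univ : Set X) := Metric.diam_nonneg
  generalize hD : Metric.diam (Set.univ : Set X) = D at *
  have hmul : ∀ k Λ : ℝ, (D + 1) * k * Λ = (D + 1) * Λ * k := fun k Λ => by ring
  -- With a single state the logarithm may vanish, but so does the regret.
  rcases subsingleton_or_nontrivial X with hX | hX
  · obtain ⟨A, hA⟩ := MetricalTaskSystem.exists_constant_algorithm M T (Classical.arbitrary X)
    refine ⟨A, fun t₀ k h l => MetricalTaskSystem.bestFixed_add_le h l fun x => ?_⟩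
    rw [Subsingleton.elim x (Classical.arbitrary X)]
    exact (hA l t₀ k h).trans (le_add_of_nonneg_right (by positivity))
  have hN : (2 : ℝ) ≤ Fintype.card X := by exact_mod_cast Fintype.one_lt_card
  -- For a short horizon, `T = 0` included, staying put has regret at most `k`. Otherwise `log (NT)
  -- ≥ 1 / 2` forces `D + 1 ≤ 2 * T`.
  rcases le_or_gt (T : ℝ) ((D + 1) * Real.log (Fintype.card X * T)) with hT | hT
  · obtain ⟨A, hA⟩ := MetricalTaskSystem.exists_constant_algorithm M T (Classical.arbitrary X)
    refine ⟨A, fun t₀ k h l => MetricalTaskSystem.bestFixed_add_le h l fun x =>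
      (hA l t₀ k h).trans ?_⟩
    have h1 : ∑ i ∈ Finset.range k,
        MetricalTaskSystem.padLoss l (t₀ + i) (Classical.arbitrary X) ≤ k := by
      calc _ ≤ ∑ i ∈ Finset.range k, (1 : ℝ) := Finset.sum_le_sum fun i _ =>
            (MetricalTaskSystem.padLoss_mem_Icc l _ _).2
        _ = k := by simp
    have h2 : 0 ≤ ∑ i ∈ Finset.range k, MetricalTaskSystem.padLoss l (t₀ + i) x :=
      Finset.sum_nonneg fun i _ => (MetricalTaskSystem.padLoss_mem_Icc l _ _).1
    have hkT : (k : ℝ) ≤ T := by exact_mod_cast (Nat.le_add_left k t₀).trans h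
    have h3 := MetricalTaskSystem.le_sqrt_mul (Nat.cast_nonneg k) (hkT.trans hT)
    rw [hmul]
    linarith [Real.sqrt_nonneg ((D + 1) * Real.log (Fintype.card X * T) * k)]
  · obtain ⟨A, hA⟩ := MetricalTaskSystem.exists_multirate_algorithm M T
    rw [hD] at hA
    refine ⟨A, fun t₀ k h l => MetricalTaskSystem.bestFixed_add_le h l fun x => ?_⟩
    obtain ⟨hA2, hAx⟩ := hA l t₀ k h
    have hT1 : (1 : ℝ) ≤ T := by
      rcases Nat.eq_zero_or_pos T with rfl | h0
      · simp at hT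
      · exact_mod_cast h0
    have hΛ2 : 1 / 2 ≤ Real.log (Fintype.card X * T) := by
      have h4 := Real.log_le_log (by norm_num) (by nlinarith : (2 : ℝ) ≤ Fintype.card X * T)
      linarith [Real.log_two_gt_d9]
    have hlog := fun hDT => MetricalTaskSystem.log_le_mul_log (T := T) hD0 hN hT1 hDT
    generalize Real.log (Fintype.card X * T) = Λ at *
    replace hlog := hlog (by nlinarith)
    rw [hmul]
    have hB : 0 < (D + 1) * Λ := by positivity
    have hk0 : (0 : ℝ) ≤ k := Nat.cast_nonneg k
    -- On short intervals the crude bound `2 * k` suffices.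
    rcases le_or_gt (k : ℝ) ((D + 1) * Λ) with hk | hk
    · have h2 : 0 ≤ ∑ i ∈ Finset.range k, MetricalTaskSystem.padLoss l (t₀ + i) x :=
        Finset.sum_nonneg fun i _ => (MetricalTaskSystem.padLoss_mem_Icc l _ _).1
      have h3 := MetricalTaskSystem.le_sqrt_mul hk0 hk
      linarith [Real.sqrt_nonneg ((D + 1) * Λ * k)]
    · have hB2 : 1 / 2 ≤ (D + 1) * Λ := by nlinarith
      generalize hBdef : (D + 1) * Λ = B at *
      set s : ℝ := Real.sqrt (k / B) with hs
      have hs2 : s ^ 2 = k / B := Real.sq_sqrt (by positivity)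
      have hs1 : 1 < s := Real.lt_sqrt_of_sq_lt (by rw [one_pow, lt_div_iff₀ hB]; linarith)
      have hkB : (k : ℝ) = s ^ 2 * B := by rw [hs2, div_mul_cancel₀ _ hB.ne']
      have hsqrt : Real.sqrt (B * k) = s * B := by
        rw [hkB, show B * (s ^ 2 * B) = (s * B) ^ 2 by ring, Real.sqrt_sq (by positivity)]
      have hkT : (k : ℝ) ≤ T := by exact_mod_cast (Nat.le_add_left k t₀).trans h
      -- The grid of rates reaches `⌈s⌉₊`: `s ^ 2 = k / B ≤ 2 * T ≤ (T + 1) ^ 2`.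
      have hsT : s ≤ T + 1 := by
        refine le_of_sq_le_sq ?_ (by linarith)
        nlinarith
      have hm := Nat.ceil_lt_add_one (zero_le_one.trans hs1.le)
      have hms := Nat.le_ceil s
      have hbound := hAx x ⌈s⌉₊ (Nat.ceil_pos.2 (by linarith))
        (Nat.ceil_le.2 (by push_cast; exact hsT))
      refine hbound.trans (add_le_add_right ?_ _)
      have h1 : 3 * (k : ℝ) / (⌈s⌉₊ : ℝ) ≤ 3 * (s * B) := by
        rw [div_le_iff₀ (by linarith), hkB]
        have := mul_le_mul_of_nonneg_left hms (by positivity : 0 ≤ 3 * (s * B))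
        linarith
      have h2 : 6 * (D + 1) * (⌈s⌉₊ : ℝ) *
          (Real.log (6 * (D + 1) * Fintype.card X * (T + 1) ^ 3) + 1) ≤ 156 * (s * B) := by
        calc _ ≤ 6 * (D + 1) * (2 * s) * (13 * Λ) := by
              refine (mul_le_mul_of_nonneg_left hlog (by positivity)).trans ?_
              refine mul_le_mul_of_nonneg_right ?_ (by positivity)
              exact mul_le_mul_of_nonneg_left (by linarith) (by positivity)
          _ = 156 * (s * ((D + 1) * Λ)) := by ring
          _ = _ := by rw [hBdef]
      rw [hsqrt]
      linarith
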